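/- **Theorem.** Let $(\Omega,\mathcal A,P)$ be a probability space, let $(T,\mathcal B,\nu)$ be a finite measure space, and let $X=(X_t)_{t\in T}$ be a centered real-valued Gaussian process over $(\Omega,\mathcal A,P)$. Let $H_X$ be the reproducing kernel Hilbert space (RKHS) on $T$ of the covariance function $k_X(s,t)=\mathbb E(X_sX_t)$, and assume that every function in $H_X$ is bounded and $\mathcal B$-measurable. Let $I_{X,\nu}:H_X\to L_2(\nu)$, $h\mapsto [h]_\sim$, be the embedding into $\nu$-equivalence classes (a bounded operator), and let $T_{X,\nu}:=I_{X,\nu}\circ I_{X,\nu}^*:L_2(\nu)\to L_2(\nu)$, which is the integral operator with kernel $k_X$. Let $(\mu_i)_{i\in I}$ be the non-zero eigenvalues of $T_{X,\nu}$, repeated according to geometric multiplicity (they are positive), and let $(e_i)_{i\in I}\subset H_X$ be a family such that $([e_i]_\sim)_{i\in I}$ is an orthonormal system in $L_2(\nu)$ and each $[e_i]_\sim$ is an eigenfunction of $T_{X,\nu}$ for the eigenvalue $\mu_i$. Then the following statements hold. (i) The operator $I_{X,\nu}$ is nuclear if and only if $\sum_{i\in I}\sqrt{\mu_i}<\infty$.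 (ii) Assume that $\nu$ is $H_X$-positive, i.e. $I_{X,\nu}$ is injective, and let $\beta\in(0,1)$ satisfy $\sum_{i\in I}\mu_i^{\beta}e_i(t)^2<\infty$ for all $t\in T$. Let $$H_X^\beta:=\Bigl\{\sum_{i\in I}a_i\mu_i^{\beta/2}e_i \;:\; (a_i)_{i\in I}\in\ell_2(I)\Bigr\}$$ (with pointwise convergence of the series) be the RKHS on $T$ for which $(\mu_i^{\beta/2}e_i)_{i\in I}$ is an orthonormal basis. For RKHSs $H_1,H_2$ on $T$ write $H_1\ll H_2$ if $H_1\subset H_2$ and the embedding map $H_1\to H_2$ is a Hilbert–Schmidt operator. Then $$H_X\ll H_X^\beta\quad\Longleftrightarrow\quad \sum_{i\in I}\mu_i^{1-\beta}<\infty .$$ In this case there exists a version $Y$ of $X$ (a process on the same probability space with $P(Y_t=X_t)=1$ for every $t\in T$) whose paths $t\mapsto Y_t(\omega)$ belong to $H_X^\beta$ for $P$-almost every $\omega$. -/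

import Mathlib

open MeasureTheory ProbabilityTheory Filter Topology
open scoped InnerProductSpace

noncomputable section

namespace GaussianPaths

universe u v w

/-! ### Nuclear and Hilbert-Schmidt operators -/

section Operators

/-- A bounded operator `S : E → F` is nuclear if `S x = ∑ₙ φₙ(x) yₙ` for some `φₙ ∈ E'`, `yₙ ∈ F`
with `∑ₙ ‖φₙ‖ ‖yₙ‖ < ∞`. -/
def IsNuclear {E F : Type*} [NormedAddCommGroup E] [NormedSpace ℝ E]
    [NormedAddCommGroup F] [NormedSpace ℝ F] (S : E →L[ℝ] F) : Prop :=
  ∃ (φ : ℕ → (E →L[ℝ] ℝ)) (y : ℕ → F),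
    Summable (fun n => ‖φ n‖ * ‖y n‖) ∧ ∀ x, HasSum (fun n => φ n x • y n) (S x)

/-- A bounded operator `S : E → F` between Hilbert spaces is Hilbert-Schmidt if
`∑_j ‖S b_j‖² < ∞` for some orthonormal basis `(b_j)` of `E`. The basis is indexed by
a set of vectors of `E`, which is no restriction. -/
def IsHilbertSchmidt {E F : Type*} [NormedAddCommGroup E] [InnerProductSpace ℝ E]
    [NormedAddCommGroup F] [InnerProductSpace ℝ F] (S : E →L[ℝ] F) : Prop :=
  ∃ (J : Set E) (b : HilbertBasis J ℝ E), Summable (fun j => ‖S (b j)‖ ^ 2)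

/-- Nuclear dominance `H₁ ≪ H₂` of RKHSs on `T`: as sets of functions `H₁ ⊆ H₂`, and the
embedding map is a Hilbert-Schmidt operator. -/
def NuclearlyDominated {T : Type u} (H₁ : Type v) (H₂ : Type w)
    [NormedAddCommGroup H₁] [InnerProductSpace ℝ H₁] [RKHS ℝ H₁ T ℝ]
    [NormedAddCommGroup H₂] [InnerProductSpace ℝ H₂] [RKHS ℝ H₂ T ℝ] : Prop :=
  ∃ J : H₁ →L[ℝ] H₂, (∀ h t, J h t = h t) ∧ IsHilbertSchmidt J

end Operators

/-! ### The RKHS of a centered Gaussian process -/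

section Covariance

variable {Ω T : Type*} [MeasurableSpace Ω]

/-- `X = (X_t)_{t ∈ T}` is a centered real Gaussian process on `(Ω, P)`. -/
structure IsCenteredGaussianProcess (X : T → Ω → ℝ) (P : Measure Ω) : Prop where
  measurable : ∀ t, Measurable (X t)
  gaussian : IsGaussianProcess X P
  centered : ∀ t, ∫ ω, X t ω ∂P = 0

/-- `Y` is a version of `X`: `Y` is a process on the same probability space with
`P(Y_t = X_t) = 1` for all `t`. -/
def IsVersion (Y X : T → Ω → ℝ) (P : Measure Ω) : Prop :=
  ∀ t, Measurable (Y t) ∧ ∀ᵐ ω ∂P, Y t ω = X t ω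

/-- The covariance function `k_X(s,t) = E (X_s X_t)`. -/
def covFun (X : T → Ω → ℝ) (P : Measure Ω) (s t : T) : ℝ := ∫ ω, X s ω * X t ω ∂P

/-- A scalar kernel as an operator-valued matrix, its entries acting on `ℝ` by multiplication. -/
def kernelMatrix (k : T → T → ℝ) : Matrix T T (ℝ →L[ℝ] ℝ) :=
  Matrix.of fun s t => k s t • ContinuousLinearMap.id ℝ ℝ

lemma posSemidef_kernelMatrix_covFun {X : T → Ω → ℝ} {P : Measure Ω}
    (hX : IsCenteredGaussianProcess X P) : (kernelMatrix (covFun X P)).PosSemidef := by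
  have hL : ∀ t, MemLp (X t) 2 P := fun t => (hX.gaussian.hasGaussianLaw_eval t).memLp_two
  have htfae := (RKHS.posSemidef_tfae (K := kernelMatrix (covFun X P))).out 0 2
  refine htfae.mpr ⟨?_, fun v => ?_⟩
  · ext s t
    simp only [kernelMatrix, covFun, Matrix.conjTranspose_apply, Matrix.of_apply]
    have hid : (ContinuousLinearMap.id ℝ ℝ).adjoint = ContinuousLinearMap.id ℝ ℝ :=
      ContinuousLinearMap.adjoint_id
    simp [mul_comm, ContinuousLinearMap.star_eq_adjoint, hid]
  · have hint : ∀ s t, Integrable (fun ω => (v s * X s ω) * (v t * X t ω)) P := fun s t => by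
      have := ((hL s).integrable_mul (hL t)).const_mul (v s * v t)
      refine this.congr (ae_of_all _ fun ω => ?_)
      simp only [Pi.mul_apply]; ring
    have key : (v.sum fun x w => v.sum fun x' w' =>
        ⟪kernelMatrix (covFun X P) x' x w, w'⟫_ℝ)
        = ∫ ω, (∑ s ∈ v.support, v s * X s ω) ^ 2 ∂P := by
      have h1 : ∀ ω, (∑ s ∈ v.support, v s * X s ω) ^ 2
          = ∑ s ∈ v.support, ∑ t ∈ v.support, (v s * X s ω) * (v t * X t ω) := fun ω => by
        rw [sq, Finset.sum_mul_sum]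
      simp_rw [h1]
      rw [integral_finsetSum _ fun s _ => integrable_finsetSum _ fun t _ => hint s t]
      refine Finset.sum_congr rfl fun s _ => ?_
      rw [integral_finsetSum _ fun t _ => hint s t]
      refine Finset.sum_congr rfl fun t _ => ?_
      have : ∀ ω, (v s * X s ω) * (v t * X t ω) = (v s * v t) * (X t ω * X s ω) :=
        fun ω => by ring
      simp_rw [this]
      rw [integral_const_mul]
      simp [kernelMatrix, covFun]
      ring
    rw [key]
    exact integral_nonneg fun ω => sq_nonneg _

/-- The RKHS `H_X` of the covariance function `k_X` of a centered Gaussian process `X`. -/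
def CovRKHS {X : T → Ω → ℝ} {P : Measure Ω} (hX : IsCenteredGaussianProcess X P) : Type _ :=
  haveI : Fact (kernelMatrix (covFun X P)).PosSemidef := ⟨posSemidef_kernelMatrix_covFun hX⟩
  RKHS.OfKernel (kernelMatrix (covFun X P))

section Instances

variable {X : T → Ω → ℝ} {P : Measure Ω} (hX : IsCenteredGaussianProcess X P)

instance : NormedAddCommGroup (CovRKHS hX) :=
  haveI : Fact (kernelMatrix (covFun X P)).PosSemidef := ⟨posSemidef_kernelMatrix_covFun hX⟩
  inferInstanceAs (NormedAddCommGroup (RKHS.OfKernel (kernelMatrix (covFun X P))))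

instance : InnerProductSpace ℝ (CovRKHS hX) :=
  haveI : Fact (kernelMatrix (covFun X P)).PosSemidef := ⟨posSemidef_kernelMatrix_covFun hX⟩
  inferInstanceAs (InnerProductSpace ℝ (RKHS.OfKernel (kernelMatrix (covFun X P))))

instance : CompleteSpace (CovRKHS hX) :=
  haveI : Fact (kernelMatrix (covFun X P)).PosSemidef := ⟨posSemidef_kernelMatrix_covFun hX⟩
  inferInstanceAs (CompleteSpace (RKHS.OfKernel (kernelMatrix (covFun X P))))

instance : RKHS ℝ (CovRKHS hX) T ℝ :=
  haveI : Fact (kernelMatrix (covFun X P)).PosSemidef := ⟨posSemidef_kernelMatrix_covFun hX⟩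
  inferInstanceAs (RKHS ℝ (RKHS.OfKernel (kernelMatrix (covFun X P))) T ℝ)

/-- The reproducing kernel of `H_X` is `k_X`. -/
lemma kernel_covRKHS : RKHS.kernel (CovRKHS hX) = kernelMatrix (covFun X P) :=
  haveI : Fact (kernelMatrix (covFun X P)).PosSemidef := ⟨posSemidef_kernelMatrix_covFun hX⟩
  RKHS.OfKernel.kernel_ofKernel (K := kernelMatrix (covFun X P))

end Instances

end Covariance

/-! ### The embedding into `L²(ν)` and the integral operator -/

section Embedding

variable {T : Type*} [MeasurableSpace T] {H : Type*} [NormedAddCommGroup H]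
  [InnerProductSpace ℝ H] [RKHS ℝ H T ℝ]

/-- The RKHS `H` consists of bounded measurable functions. -/
def BoundedMeasurable (H : Type*) [NormedAddCommGroup H] [InnerProductSpace ℝ H]
    [RKHS ℝ H T ℝ] : Prop :=
  ∀ h : H, Measurable (h : T → ℝ) ∧ ∃ C : ℝ, ∀ t, |h t| ≤ C

lemma BoundedMeasurable.memLp (hH : BoundedMeasurable (T := T) H) (ν : Measure T)
    [IsFiniteMeasure ν] (h : H) : MemLp (h : T → ℝ) 2 ν := by
  obtain ⟨hm, C, hC⟩ := hH h
  exact MemLp.of_bound hm.aestronglyMeasurable C (ae_of_all _ fun t => hC t)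

lemma BoundedMeasurable.exists_bound [CompleteSpace H] (hH : BoundedMeasurable (T := T) H) :
    ∃ C : ℝ, 0 ≤ C ∧ ∀ (h : H) t, |h t| ≤ C * ‖h‖ := by
  obtain ⟨C, hC⟩ := banach_steinhaus
    (g := fun t : T => (ContinuousLinearMap.proj t ∘L RKHS.coeCLM ℝ (H := H) : H →L[ℝ] ℝ))
    (fun h => by
      obtain ⟨-, C, hC⟩ := hH h
      exact ⟨C, fun t => by simpa using hC t⟩)
  refine ⟨max C 0, le_max_right _ _, fun h t => ?_⟩
  have h1 := (ContinuousLinearMap.proj t ∘L RKHS.coeCLM ℝ (H := H) : H →L[ℝ] ℝ).le_opNorm h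
  exact h1.trans (mul_le_mul_of_nonneg_right ((hC t).trans (le_max_left _ _)) (norm_nonneg _))

variable [CompleteSpace H]

/-- The embedding operator `I_ν : H → L²(ν)`, `h ↦ [h]`. -/
def toL2 (hH : BoundedMeasurable (T := T) H) (ν : Measure T) [IsFiniteMeasure ν] :
    H →L[ℝ] Lp ℝ 2 ν :=
  LinearMap.mkContinuousOfExistsBound
    { toFun := fun h => (hH.memLp ν h).toLp h
      map_add' := fun f g => by
        rw [← MemLp.toLp_add]; congr 1; simp
      map_smul' := fun c f => by
        rw [RingHom.id_apply, ← MemLp.toLp_const_smul]; congr 1; simp }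
    (by
      obtain ⟨C, hC0, hC⟩ := hH.exists_bound
      refine ⟨(measureUnivNNReal ν : ℝ) ^ (2 : ENNReal).toReal⁻¹ * C, fun h => ?_⟩
      rw [mul_assoc]
      refine Lp.norm_le_of_ae_bound (mul_nonneg hC0 (norm_nonneg h)) ?_
      filter_upwards [(hH.memLp ν h).coeFn_toLp] with t ht
      change ‖(hH.memLp ν h).toLp h t‖ ≤ _
      rw [ht]
      exact hC h t)

lemma coeFn_toL2 (hH : BoundedMeasurable (T := T) H) (ν : Measure T) [IsFiniteMeasure ν]
    (h : H) : (toL2 hH ν h : T → ℝ) =ᵐ[ν] h :=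
  (hH.memLp ν h).coeFn_toLp

/-- The operator `T_ν = I_ν ∘ I_ν^* : L²(ν) → L²(ν)`. -/
def integralOp (hH : BoundedMeasurable (T := T) H) (ν : Measure T) [IsFiniteMeasure ν] :
    Lp ℝ 2 ν →L[ℝ] Lp ℝ 2 ν :=
  toL2 hH ν ∘L (toL2 hH ν).adjoint

/-- `ν` is `H`-positive: the embedding `I_ν : H → L²(ν)` is injective. -/
def IsPositiveFor (hH : BoundedMeasurable (T := T) H) (ν : Measure T) [IsFiniteMeasure ν] : Prop :=
  Function.Injective (toL2 hH ν)

/-- `(μ_i)` are the non-zero eigenvalues of `T_ν`, repeated according to their geometric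
multiplicities, and `(e_i)` is a family in `H` such that `([e_i])` is an orthonormal system in
`L²(ν)` and `[e_i]` is an eigenfunction of `T_ν` to the eigenvalue `μ_i`. -/
structure IsEigensystem (hH : BoundedMeasurable (T := T) H) (ν : Measure T) [IsFiniteMeasure ν]
    {ι : Type*} (μ : ι → ℝ) (e : ι → H) : Prop where
  ne_zero : ∀ i, μ i ≠ 0
  multiplicity : ∀ c : ℝ, c ≠ 0 → Set.encard {i | μ i = c} =
    Module.finrank ℝ (Module.End.eigenspace (integralOp hH ν : Lp ℝ 2 ν →ₗ[ℝ] Lp ℝ 2 ν) c)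
  orthonormal : Orthonormal ℝ fun i => toL2 hH ν (e i)
  eigen : ∀ i, integralOp hH ν (toL2 hH ν (e i)) = μ i • toL2 hH ν (e i)

variable {hH : BoundedMeasurable (T := T) H} {ν : Measure T} [IsFiniteMeasure ν]
  {ι : Type*} {μ : ι → ℝ} {e : ι → H}

lemma IsEigensystem.pos (he : IsEigensystem hH ν μ e) (i : ι) : 0 < μ i := by
  refine lt_of_le_of_ne ?_ (he.ne_zero i).symm
  have h1 : ⟪integralOp hH ν (toL2 hH ν (e i)), toL2 hH ν (e i)⟫_ℝ = μ i := by
    rw [he.eigen, real_inner_smul_left, real_inner_self_eq_norm_sq, he.orthonormal.1 i]; simp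
  rw [← h1, integralOp, ContinuousLinearMap.comp_apply,
    ← ContinuousLinearMap.adjoint_inner_right]
  exact real_inner_self_nonneg

lemma IsEigensystem.le_norm (he : IsEigensystem hH ν μ e) (i : ι) :
    μ i ≤ ‖integralOp hH ν‖ := by
  have h := (integralOp hH ν).le_opNorm (toL2 hH ν (e i))
  rw [he.eigen, norm_smul, he.orthonormal.1 i, mul_one, mul_one] at h
  exact (le_abs_self _).trans h

/-! ### The power spaces -/

/-- The summability condition `∑_i μ_i^β e_i(t)² < ∞` for all `t`. -/
def PowerSummable (μ : ι → ℝ) (e : ι → H) (β : ℝ) : Prop :=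
  ∀ t, Summable fun i => μ i ^ β * e i t ^ 2

/-- The sequence `(μ_i^{β/2} e_i(t))_i ∈ ℓ²(ι)`. -/
def powerFeature (he : IsEigensystem hH ν μ e) {β : ℝ} (hs : PowerSummable μ e β) (t : T) :
    lp (fun _ : ι => ℝ) 2 :=
  ⟨fun i => μ i ^ (β / 2) * e i t, by
    refine memℓp_gen ((hs t).congr fun i => ?_)
    have h0 := (he.pos i).le
    simp only [ENNReal.toReal_ofNat, Real.rpow_two, Real.norm_eq_abs, sq_abs]
    rw [mul_pow, ← Real.rpow_natCast (μ i ^ (β / 2)), ← Real.rpow_mul h0]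
    norm_num⟩

/-- For `a ∈ ℓ²(ι)` the series `∑_i a_i μ_i^{β/2} e_i(t)` converges, for every `t`. -/
lemma hasSum_power (he : IsEigensystem hH ν μ e) {β : ℝ} (hs : PowerSummable μ e β)
    (a : lp (fun _ : ι => ℝ) 2) (t : T) :
    HasSum (fun i => a i * (μ i ^ (β / 2) * e i t)) (∑' i, a i * (μ i ^ (β / 2) * e i t)) := by
  have h := lp.summable_inner (𝕜 := ℝ) (powerFeature he hs t) a
  exact (h.congr fun i => by simp [powerFeature]).hasSum

lemma inner_powerFeature (he : IsEigensystem hH ν μ e) {β : ℝ} (hs : PowerSummable μ e β)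
    (a : lp (fun _ : ι => ℝ) 2) (t : T) :
    ⟪powerFeature he hs t, a⟫_ℝ = ∑' i, a i * (μ i ^ (β / 2) * e i t) := by
  rw [lp.inner_eq_tsum]
  exact tsum_congr fun i => by simp [powerFeature]

/-- A family `a ∈ ℓ²(ι)` is determined by the function `∑_i a_i μ_i^{β/2} e_i`. -/
lemma eq_zero_of_power_eq_zero (he : IsEigensystem hH ν μ e) {β : ℝ} (hβ : 0 < β)
    (hs : PowerSummable μ e β) (a : lp (fun _ : ι => ℝ) 2)
    (h : ∀ t, ∑' i, a i * (μ i ^ (β / 2) * e i t) = 0) : a = 0 := by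
  -- the family `(a_i μ_i^{β/2})` is square summable since `(μ_i)` is bounded
  have hb : ∀ i, |μ i ^ (β / 2)| ≤ ‖integralOp hH ν‖ ^ (β / 2) := fun i => by
    rw [abs_of_nonneg (Real.rpow_nonneg (he.pos i).le _)]
    exact Real.rpow_le_rpow (he.pos i).le (he.le_norm i) (by positivity)
  let b : lp (fun _ : ι => ℝ) 2 := ⟨fun i => a i * μ i ^ (β / 2), by
    refine memℓp_gen ?_
    have ha := ((lp.memℓp a).summable (by norm_num)).mul_left
      ((‖integralOp hH ν‖ ^ (β / 2)) ^ 2)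
    refine ha.of_nonneg_of_le (fun i => by positivity) fun i => ?_
    simp only [ENNReal.toReal_ofNat, Real.rpow_two, norm_mul, mul_pow]
    rw [mul_comm]
    refine mul_le_mul_of_nonneg_right ?_ (sq_nonneg _)
    exact pow_le_pow_left₀ (norm_nonneg _) (hb i) 2⟩
  have hV := he.orthonormal.orthogonalFamily
  have hsum := hV.hasSum_linearIsometry b
  set g := hV.linearIsometry b with hg
  -- restrict to the countable support
  let S : Set ι := {i | a i ≠ 0}
  have hS : S.Countable := by
    have h1 := ((lp.memℓp a).summable (by norm_num)).countable_support
    refine h1.mono fun i hi => ?_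
    have : 0 < ‖a i‖ := norm_pos_iff.mpr hi
    exact (Real.rpow_pos_of_pos this _).ne'
  have : Countable S := hS.to_subtype
  have hsumS : HasSum (fun i : S => (a i * μ i ^ (β / 2)) • toL2 hH ν (e i)) g := by
    refine (hasSum_subtype_iff_of_support_subset (s := S)
      (f := fun i => (a i * μ i ^ (β / 2)) • toL2 hH ν (e i)) ?_).mpr hsum
    intro i hi hi0
    apply hi
    have : a i = 0 := by simpa [S] using hi0
    simp [this]
  obtain ⟨ns, hns, hae⟩ := (tendstoInMeasure_of_tendsto_Lp hsumS).exists_seq_tendsto_ae'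
  have hpt : ∀ t, Tendsto (fun s : Finset S => ∑ i ∈ s, (a i * μ i ^ (β / 2)) * e i t)
      atTop (𝓝 0) := fun t => by
    have h1 := hasSum_power he hs a t
    rw [h t] at h1
    have h2 : HasSum (fun i : S => (a i * (μ i ^ (β / 2) * e i t))) 0 := by
      refine (hasSum_subtype_iff_of_support_subset (s := S)
        (f := fun i => a i * (μ i ^ (β / 2) * e i t)) ?_).mpr h1
      intro i hi hi0
      apply hi
      have : a i = 0 := by simpa [S] using hi0
      simp [this]
    simp only [mul_assoc]
    exact h2
  have hcoe : ∀ n, ((∑ i ∈ ns n, (a i * μ i ^ (β / 2)) • toL2 hH ν (e i) : Lp ℝ 2 ν) : T → ℝ)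
      =ᵐ[ν] fun t => ∑ i ∈ ns n, (a i * μ i ^ (β / 2)) * e i t := fun n => by
    have h1 : (∑ i ∈ ns n, (a i * μ i ^ (β / 2)) • toL2 hH ν (e i) : Lp ℝ 2 ν)
        = toL2 hH ν (∑ i ∈ ns n, (a i * μ i ^ (β / 2)) • e i) := by simp
    rw [h1]
    filter_upwards [coeFn_toL2 hH ν (∑ i ∈ ns n, (a i * μ i ^ (β / 2)) • e i)] with t ht
    rw [ht]
    refine (map_sum (ContinuousLinearMap.proj t ∘L RKHS.coeCLM ℝ (H := H) : H →L[ℝ] ℝ)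
      (fun i : S => (a i * μ i ^ (β / 2)) • e i) (ns n)).trans ?_
    exact Finset.sum_congr rfl fun i _ => by simp
  have hg0 : g = 0 := by
    refine (Lp.eq_zero_iff_ae_eq_zero).mpr ?_
    filter_upwards [hae, ae_all_iff.mpr hcoe] with t ht1 ht2
    refine tendsto_nhds_unique ht1 ?_
    simp only [ht2]
    exact (hpt t).comp hns
  have hb0 : b = 0 := by
    rw [hg0] at hg
    exact hV.linearIsometry.injective (hg.symm.trans (map_zero _).symm)
  ext i
  have hbi : a i * μ i ^ (β / 2) = 0 := congrFun (congrArg Subtype.val hb0) i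
  simpa using (mul_eq_zero.mp hbi).resolve_right (Real.rpow_pos_of_pos (he.pos i) _).ne'

/-- The space `H^β = {∑_i a_i μ_i^{β/2} e_i : a ∈ ℓ²(ι)}` with the norm that makes
`(μ_i^{β/2} e_i)` an orthonormal basis. An element is stored as its coefficient family
`a ∈ ℓ²(ι)`, which the function determines. -/
def PowerSpace (_he : IsEigensystem hH ν μ e) {β : ℝ} (_hβ : 0 < β)
    (_hs : PowerSummable μ e β) : Type _ :=
  lp (fun _ : ι => ℝ) 2

section Instances

variable (he : IsEigensystem hH ν μ e) {β : ℝ} (hβ : 0 < β) (hs : PowerSummable μ e β)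

instance : NormedAddCommGroup (PowerSpace he hβ hs) :=
  inferInstanceAs (NormedAddCommGroup (lp (fun _ : ι => ℝ) 2))

instance : InnerProductSpace ℝ (PowerSpace he hβ hs) :=
  inferInstanceAs (InnerProductSpace ℝ (lp (fun _ : ι => ℝ) 2))

instance : CompleteSpace (PowerSpace he hβ hs) :=
  inferInstanceAs (CompleteSpace (lp (fun _ : ι => ℝ) 2))

instance : RKHS ℝ (PowerSpace he hβ hs) T ℝ where
  coeCLM := show lp (fun _ : ι => ℝ) 2 →L[ℝ] T → ℝ from
    { toFun := fun a t => ∑' i, a i * (μ i ^ (β / 2) * e i t)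
      map_add' := fun a b => by
        ext t; simp only [← inner_powerFeature he hs, inner_add_right, Pi.add_apply]
      map_smul' := fun c a => by
        ext t
        simp only [← inner_powerFeature he hs, inner_smul_right, Pi.smul_apply, smul_eq_mul,
          RingHom.id_apply]
      cont := by
        refine continuous_pi fun t => ?_
        simp only [← inner_powerFeature he hs]
        fun_prop }
  coeCLM_injective := by
    refine (injective_iff_map_eq_zero _).mpr fun a ha => ?_
    exact eq_zero_of_power_eq_zero he hβ hs a fun t => congrFun ha t

/-- The functions in `H^β` are exactly the sums `∑_i a_i μ_i^{β/2} e_i` with `a ∈ ℓ²(ι)`. -/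
lemma powerSpace_apply (a : PowerSpace he hβ hs) (t : T) :
    a t = ∑' i, (show lp (fun _ : ι => ℝ) 2 from a) i * (μ i ^ (β / 2) * e i t) :=
  rfl

end Instances

end Embedding

end GaussianPaths

end

/-!
The embedding `I : H → L²(ν)` of an RKHS of bounded measurable functions is Hilbert–Schmidt, so
`I I*` is compact and the spectral theorem turns its eigenpairs into a singular value decomposition
`I h = ∑ᵢ √μᵢ ⟪uᵢ, h⟫ [eᵢ]`. Testing a nuclear representation of `I` against the singular vectors
bounds `∑ᵢ √μᵢ`, which gives (i). If `I` is injective, the `uᵢ = √μᵢ eᵢ` form an orthonormal basis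
of `H`; the norm of `uᵢ` in `H^β` is `μᵢ^((1-β)/2)`, and since the Hilbert–Schmidt property can be
tested on any one basis, `H ≪ H^β` amounts to `∑ᵢ μᵢ^(1-β) < ∞`.

For the paths (Lukić–Beder), let `J : H₁ → H₂` be a Hilbert–Schmidt embedding of RKHSs with kernels
`k₁, k₂`, and `Ψ : H₁ → L²(P)` the Loève isometry `k₁(t, ·) ↦ X_t`. As `J* k₂(t, ·) = k₁(t, ·)`,
expanding `k₂(t, ·)` along an orthonormal basis `(fₖ)` of `H₂` yields `X_t = ∑ₖ fₖ(t) Ψ(J* fₖ)` in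
`L²(P)`. Since `∑ₖ ‖Ψ(J* fₖ)‖² < ∞`, the series `∑ₖ Ψ(J* fₖ)(ω) fₖ` converges in `H₂` for almost
every `ω`, and its sum is the path of the version.
-/

namespace GaussianPaths

section Nuclear

variable {E F ι : Type*}

lemma IsNuclear.of_hasSum [NormedAddCommGroup E] [NormedSpace ℝ E] [NormedAddCommGroup F]
    [NormedSpace ℝ F] {S : E →L[ℝ] F} {φ : ι → E →L[ℝ] ℝ} {y : ι → F}
    (hφy : Summable fun i => ‖φ i‖ * ‖y i‖) (hS : ∀ x, HasSum (fun i => φ i x • y i) (S x)) :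
    IsNuclear S := by
  set s := Function.support fun i => ‖φ i‖ * ‖y i‖ with hs
  have : Countable s := hφy.countable_support.to_subtype
  obtain ⟨g, hg⟩ := exists_injective_nat s
  refine ⟨Function.extend g (fun i => φ i) 0, Function.extend g (fun i => y i) 0,
    (hg.summable_iff fun n hn => ?_).mp ?_, fun x => (hg.hasSum_iff fun n hn => ?_).mp ?_⟩
  · rw [Function.extend_apply' _ _ _ hn, Pi.zero_apply, norm_zero, zero_mul]
  · simp only [Function.comp_def, hg.extend_apply]
    exact hφy.subtype s
  · rw [Function.extend_apply' _ _ _ hn, Pi.zero_apply, zero_apply, zero_smul]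
  · have hsupp : Function.support (fun i => φ i x • y i) ⊆ s := by
      refine Function.support_subset_iff'.mpr fun i hi => ?_
      rw [hs, Function.notMem_support, mul_eq_zero, norm_eq_zero, norm_eq_zero] at hi
      obtain hi | hi := hi <;> simp [hi]
    simpa only [Function.comp_def, hg.extend_apply] using
      (hasSum_subtype_iff_of_support_subset hsupp).mpr (hS x)

variable [NormedAddCommGroup E] [InnerProductSpace ℝ E] [CompleteSpace E]
  [NormedAddCommGroup F] [InnerProductSpace ℝ F] {u : ι → E} {v : ι → F}

lemma sum_abs_apply_mul_abs_inner_le (hu : Orthonormal ℝ u) (hv : Orthonormal ℝ v)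
    (φ : E →L[ℝ] ℝ) (y : F) (s : Finset ι) :
    ∑ i ∈ s, |φ (u i)| * |⟪v i, y⟫_ℝ| ≤ ‖φ‖ * ‖y‖ := by
  have bessel_dual : ∑ i ∈ s, |φ (u i)| ^ 2 ≤ ‖φ‖ ^ 2 := by
    simpa [real_inner_comm ((InnerProductSpace.toDual ℝ E).symm φ)] using
      hu.sum_inner_products_le (s := s) ((InnerProductSpace.toDual ℝ E).symm φ)
  have bessel : ∑ i ∈ s, |⟪v i, y⟫_ℝ| ^ 2 ≤ ‖y‖ ^ 2 := hv.sum_inner_products_le y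
  refine (Real.sum_mul_le_sqrt_mul_sqrt s _ _).trans ?_
  gcongr
  · exact Real.sqrt_le_iff.mpr ⟨norm_nonneg _, bessel_dual⟩
  · exact Real.sqrt_le_iff.mpr ⟨norm_nonneg _, bessel⟩

lemma IsNuclear.summable_inner {S : E →L[ℝ] F} (hS : IsNuclear S) (hu : Orthonormal ℝ u)
    (hv : Orthonormal ℝ v) : Summable fun i => ⟪v i, S (u i)⟫_ℝ := by
  obtain ⟨φ, y, hφy, hsum⟩ := hS
  have hcoeff i : HasSum (fun n => φ n (u i) * ⟪v i, y n⟫_ℝ) ⟪v i, S (u i)⟫_ℝ := by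
    simpa [real_inner_smul_right] using (hsum (u i)).mapL (innerSL ℝ (v i))
  refine .of_abs (summable_of_sum_le (c := ∑' n, ‖φ n‖ * ‖y n‖) (fun i => abs_nonneg _)
    fun s => ?_)
  have habs i : HasSum (fun n => SignType.sign ⟪v i, S (u i)⟫_ℝ * (φ n (u i) * ⟪v i, y n⟫_ℝ))
      |⟪v i, S (u i)⟫_ℝ| := by
    simpa only [sign_mul_self] using (hcoeff i).mul_left (SignType.sign ⟪v i, S (u i)⟫_ℝ : ℝ)
  refine hasSum_le (fun n => ?_) (hasSum_sum fun i (_ : i ∈ s) => habs i) hφy.hasSum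
  refine le_trans (Finset.sum_le_sum fun i _ => ?_) (sum_abs_apply_mul_abs_inner_le hu hv _ _ s)
  rw [← abs_mul]
  obtain h | h | h := SignType.trichotomy (SignType.sign ⟪v i, S (u i)⟫_ℝ) <;>
    simp [h, -abs_mul, neg_le_abs, le_abs_self]

end Nuclear

section HilbertSchmidt

variable {E F ι κ : Type*} [NormedAddCommGroup E] [InnerProductSpace ℝ E]
  [NormedAddCommGroup F] [InnerProductSpace ℝ F]

lemma summable_prod_inner_sq_iff (c : HilbertBasis κ ℝ F) (y : ι → F) :
    Summable (fun p : ι × κ => ⟪y p.1, c p.2⟫_ℝ ^ 2) ↔ Summable fun i => ‖y i‖ ^ 2 := by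
  have parseval i : HasSum (fun k => ⟪y i, c k⟫_ℝ ^ 2) (‖y i‖ ^ 2) := by
    simpa only [real_inner_self_eq_norm_sq, sq, real_inner_comm (y i)] using
      c.hasSum_inner_mul_inner (y i) (y i)
  rw [summable_prod_of_nonneg fun p => sq_nonneg _]
  simp only [(parseval _).tsum_eq, (parseval _).summable, implies_true, true_and]

lemma summable_norm_adjoint_sq_iff [CompleteSpace E] [CompleteSpace F] (b : HilbertBasis ι ℝ E)
    (c : HilbertBasis κ ℝ F) (S : E →L[ℝ] F) :
    Summable (fun k => ‖S.adjoint (c k)‖ ^ 2) ↔ Summable fun i => ‖S (b i)‖ ^ 2 := by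
  rw [← summable_prod_inner_sq_iff b, ← summable_prod_inner_sq_iff c,
    ← (Equiv.prodComm ι κ).summable_iff]
  simp only [Function.comp_def, Equiv.prodComm_apply, Prod.fst_swap, Prod.snd_swap,
    ContinuousLinearMap.adjoint_inner_left, real_inner_comm]

lemma isHilbertSchmidt_iff_summable [CompleteSpace E] [CompleteSpace F] (b : HilbertBasis ι ℝ E)
    {S : E →L[ℝ] F} : IsHilbertSchmidt S ↔ Summable fun i => ‖S (b i)‖ ^ 2 := by
  obtain ⟨_, c, -⟩ := exists_hilbertBasis ℝ F
  constructor
  · rintro ⟨J, b', hb'⟩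
    rwa [← summable_norm_adjoint_sq_iff b c, summable_norm_adjoint_sq_iff b' c]
  · intro hS
    have hdense : ⊤ ≤ (Submodule.span ℝ (Set.range ((↑) : Set.range b → E))).topologicalClosure :=
      by rw [Subtype.range_coe, b.dense_span]
    refine ⟨Set.range b, HilbertBasis.mk b.orthonormal.toSubtypeRange hdense, ?_⟩
    rwa [HilbertBasis.coe_mk,
      ← (Equiv.ofInjective b b.orthonormal.linearIndependent.injective).summable_iff]

lemma IsHilbertSchmidt.summable_adjoint [CompleteSpace E] [CompleteSpace F] {S : E →L[ℝ] F}
    (hS : IsHilbertSchmidt S) (c : HilbertBasis κ ℝ F) :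
    Summable fun k => ‖S.adjoint (c k)‖ ^ 2 := by
  obtain ⟨J, b, hb⟩ := hS
  exact (summable_norm_adjoint_sq_iff b c S).mpr hb

lemma norm_sum_smulRight_le {b : ι → E} (hb : Orthonormal ℝ b) (y : ι → F) (s : Finset ι) :
    ‖∑ i ∈ s, (innerSL ℝ (b i)).smulRight (y i)‖ ≤ √(∑ i ∈ s, ‖y i‖ ^ 2) := by
  refine ContinuousLinearMap.opNorm_le_bound _ (Real.sqrt_nonneg _) fun x => ?_
  simp only [sum_apply, ContinuousLinearMap.smulRight_apply, innerSL_apply_apply]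
  calc ‖∑ i ∈ s, ⟪b i, x⟫_ℝ • y i‖ ≤ ∑ i ∈ s, ‖y i‖ * ‖⟪b i, x⟫_ℝ‖ :=
        norm_sum_le_of_le _ fun i _ => by rw [norm_smul, mul_comm]
    _ ≤ √(∑ i ∈ s, ‖y i‖ ^ 2) * √(∑ i ∈ s, ‖⟪b i, x⟫_ℝ‖ ^ 2) :=
        Real.sum_mul_le_sqrt_mul_sqrt s _ _
    _ ≤ √(∑ i ∈ s, ‖y i‖ ^ 2) * ‖x‖ := by
        gcongr
        exact Real.sqrt_le_iff.mpr ⟨norm_nonneg _, hb.sum_inner_products_le x⟩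

lemma clm_ext_of_hilbertBasis (b : HilbertBasis ι ℝ E) {R S : E →L[ℝ] F}
    (h : ∀ i, R (b i) = S (b i)) : R = S := by
  refine ContinuousLinearMap.ext_on ?_ (Set.forall_mem_range.mpr h : Set.EqOn R S (Set.range b))
  exact Submodule.dense_iff_topologicalClosure_eq_top.mpr b.dense_span

variable [CompleteSpace F]

lemma summable_smulRight_of_orthonormal {b : ι → E} (hb : Orthonormal ℝ b) {y : ι → F}
    (hy : Summable fun i => ‖y i‖ ^ 2) :
    Summable fun i => (innerSL ℝ (b i)).smulRight (y i) := by
  refine summable_iff_vanishing_norm.mpr fun ε hε => ?_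
  obtain ⟨s, hs⟩ := summable_iff_vanishing_norm.mp hy (ε ^ 2) (by positivity)
  refine ⟨s, fun t ht => (norm_sum_smulRight_le hb y t).trans_lt ?_⟩
  exact (Real.sqrt_lt' hε).mpr ((le_abs_self _).trans_lt (hs t ht))

lemma tsum_smulRight_apply_of_orthonormal {b : ι → E} (hb : Orthonormal ℝ b) {y : ι → F}
    (hy : Summable fun i => ‖y i‖ ^ 2) (i : ι) :
    (∑' j, (innerSL ℝ (b j)).smulRight (y j)) (b i) = y i := by
  have happly := (summable_smulRight_of_orthonormal hb hy).hasSum.mapL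
    (ContinuousLinearMap.apply ℝ F (b i))
  refine happly.unique ?_
  have hzero j (hj : j ≠ i) : ⟪b j, b i⟫_ℝ • y j = 0 := by rw [hb.2 hj, zero_smul]
  simpa [hb.1 i] using hasSum_single i hzero

lemma exists_clm_apply_eq (b : HilbertBasis ι ℝ E) {y : ι → F}
    (hy : Summable fun i => ‖y i‖ ^ 2) : ∃ S : E →L[ℝ] F, ∀ i, S (b i) = y i :=
  ⟨_, tsum_smulRight_apply_of_orthonormal b.orthonormal hy⟩

lemma IsHilbertSchmidt.isCompactOperator {S : E →L[ℝ] F} (hS : IsHilbertSchmidt S) :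
    IsCompactOperator S := by
  obtain ⟨J, b, hb⟩ := hS
  have hsum : HasSum (fun i => (innerSL ℝ (b i)).smulRight (S (b i))) S := by
    convert! (summable_smulRight_of_orthonormal b.orthonormal hb).hasSum
    exact clm_ext_of_hilbertBasis b fun i =>
      (tsum_smulRight_apply_of_orthonormal b.orthonormal hb i).symm
  refine isCompactOperator_of_tendsto hsum (Eventually.of_forall fun s => ?_)
  refine Submodule.sum_mem (compactOperator (RingHom.id ℝ) E F) fun i _ => ?_
  exact (isCompactOperator_of_locallyCompactSpace_dom (innerSL ℝ (b i))).clm_comp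
    (ContinuousLinearMap.toSpanSingleton ℝ (S (b i)))

end HilbertSchmidt

section NuclearDominance

variable {T H₁ H₂ ι : Type*} [NormedAddCommGroup H₁] [InnerProductSpace ℝ H₁] [CompleteSpace H₁]
  [RKHS ℝ H₁ T ℝ] [NormedAddCommGroup H₂] [InnerProductSpace ℝ H₂] [CompleteSpace H₂]
  [RKHS ℝ H₂ T ℝ]

lemma nuclearlyDominated_iff_of_hilbertBasis (b : HilbertBasis ι ℝ H₁) {g : ι → H₂}
    (hg : ∀ i t, g i t = b i t) :
    NuclearlyDominated H₁ H₂ ↔ Summable fun i => ‖g i‖ ^ 2 := by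
  constructor
  · rintro ⟨J, hJ, hS⟩
    have hJb i : J (b i) = g i := RKHS.ext fun t => (hJ (b i) t).trans (hg i t).symm
    simpa only [hJb] using (isHilbertSchmidt_iff_summable b).mp hS
  · intro hsum
    obtain ⟨J, hJ⟩ := exists_clm_apply_eq b hsum
    refine ⟨J, fun h t => ?_, ?_⟩
    · have heval : innerSL ℝ (RKHS.kerFun H₂ t (1 : ℝ)) ∘L J =
          innerSL ℝ (RKHS.kerFun H₁ t (1 : ℝ)) :=
        clm_ext_of_hilbertBasis b fun i => by simp [hJ, hg]
      simpa using DFunLike.congr_fun heval h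
    · simpa only [isHilbertSchmidt_iff_summable b, hJ] using hsum

end NuclearDominance

section SingularSystem

variable {E F ι : Type*} [NormedAddCommGroup E] [InnerProductSpace ℝ E]
  [NormedAddCommGroup F] [InnerProductSpace ℝ F]

/-- A singular value decomposition of `S`: the expansion `S x = ∑ᵢ σᵢ ⟪uᵢ, x⟫ vᵢ` along orthonormal
systems `u` of right and `v` of left singular vectors. No sign is imposed on the `σᵢ`. -/
structure IsSingularSystem (S : E →L[ℝ] F) (σ : ι → ℝ) (u : ι → E) (v : ι → F) : Prop where
  orthonormal_right : Orthonormal ℝ u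
  orthonormal_left : Orthonormal ℝ v
  hasSum : ∀ x, HasSum (fun i => (σ i * ⟪u i, x⟫_ℝ) • v i) (S x)

namespace IsSingularSystem

variable {S : E →L[ℝ] F} {σ : ι → ℝ} {u : ι → E} {v : ι → F}

lemma apply_right (h : IsSingularSystem S σ u v) (i : ι) : S (u i) = σ i • v i := by
  refine (h.hasSum (u i)).unique ?_
  have hzero j (hj : j ≠ i) : (σ j * ⟪u j, u i⟫_ℝ) • v j = 0 := by
    rw [h.orthonormal_right.2 hj, mul_zero, zero_smul]
  simpa [h.orthonormal_right.1 i] using hasSum_single i hzero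

lemma inner_apply_right (h : IsSingularSystem S σ u v) (i : ι) : ⟪v i, S (u i)⟫_ℝ = σ i := by
  rw [h.apply_right, real_inner_smul_right, real_inner_self_eq_norm_sq, h.orthonormal_left.1 i,
    one_pow, mul_one]

lemma isNuclear_iff [CompleteSpace E] (h : IsSingularSystem S σ u v) :
    IsNuclear S ↔ Summable σ := by
  refine ⟨fun hS => ?_, fun hσ => ?_⟩
  · simpa only [h.inner_apply_right] using
      hS.summable_inner h.orthonormal_right h.orthonormal_left
  · refine IsNuclear.of_hasSum (φ := fun i => σ i • innerSL ℝ (u i)) (y := v) ?_ h.hasSum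
    simpa [norm_smul, h.orthonormal_right.1 _, h.orthonormal_left.1 _] using hσ.abs

lemma orthogonal_span_right_eq_bot (h : IsSingularSystem S σ u v) (hS : Function.Injective S) :
    (Submodule.span ℝ (Set.range u))ᗮ = ⊥ := by
  refine (Submodule.eq_bot_iff _).mpr fun x hx => hS ?_
  have hux i : ⟪u i, x⟫_ℝ = 0 := hx _ (Submodule.subset_span ⟨i, rfl⟩)
  rw [map_zero]
  refine (h.hasSum x).unique ?_
  simpa only [hux, mul_zero, zero_smul] using hasSum_zero

end IsSingularSystem

lemma hasSum_inner_smul_of_mem_closure_span [CompleteSpace F] {v : ι → F} (hv : Orthonormal ℝ v)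
    {y : F} (hy : y ∈ (Submodule.span ℝ (Set.range v)).topologicalClosure) :
    HasSum (fun i => ⟪v i, y⟫_ℝ • v i) y := by
  classical
  have hrange : LinearMap.range hv.orthogonalFamily.linearIsometry.toLinearMap =
      (Submodule.span ℝ (Set.range v)).topologicalClosure := by
    rw [OrthogonalFamily.range_linearIsometry]
    simp [← LinearMap.span_singleton_eq_range, ← Submodule.span_iUnion]
  obtain ⟨a, rfl⟩ := hrange ▸ hy
  have hcoeff i : ⟪v i, hv.orthogonalFamily.linearIsometry a⟫_ℝ = a i := by
    have hvi : v i = hv.orthogonalFamily.linearIsometry (lp.single 2 i (1 : ℝ)) := by simp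
    rw [hvi, LinearIsometry.inner_map_map, lp.inner_single_left]
    simp
  simpa [hcoeff] using hv.orthogonalFamily.hasSum_linearIsometry a

lemma IsSingularSystem.of_eigenvectors [CompleteSpace E] [CompleteSpace F] {S : E →L[ℝ] F}
    {μ : ι → ℝ} {v : ι → F} (hμ : ∀ i, 0 < μ i) (hv : Orthonormal ℝ v)
    (heigen : ∀ i, S (S.adjoint (v i)) = μ i • v i)
    (hker : (Submodule.span ℝ (Set.range v))ᗮ ≤ S.adjoint.ker) :
    IsSingularSystem S (fun i => √(μ i)) (fun i => (√(μ i))⁻¹ • S.adjoint (v i)) v := by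
  classical
  have hsqrt i : √(μ i) ≠ 0 := (Real.sqrt_pos.mpr (hμ i)).ne'
  refine ⟨orthonormal_iff_ite.mpr fun i j => ?_, hv, fun x => ?_⟩
  · rw [real_inner_smul_left, real_inner_smul_right, ContinuousLinearMap.adjoint_inner_left,
      heigen, real_inner_smul_right, orthonormal_iff_ite.mp hv]
    split_ifs with hij
    · rw [hij, mul_one, ← mul_assoc, ← mul_inv, Real.mul_self_sqrt (hμ j).le,
        inv_mul_cancel₀ (hμ j).ne']
    · simp only [mul_zero]
  · have hmem : S x ∈ (Submodule.span ℝ (Set.range v)).topologicalClosure := by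
      rw [← Submodule.orthogonal_orthogonal_eq_closure]
      refine Submodule.orthogonal_le hker ?_
      rw [← ContinuousLinearMap.orthogonal_range]
      exact Submodule.le_orthogonal_orthogonal _ ⟨x, rfl⟩
    simpa [real_inner_smul_left, ContinuousLinearMap.adjoint_inner_left, hsqrt] using
      hasSum_inner_smul_of_mem_closure_span hv hmem

end SingularSystem

section Spectral

lemma eigenspace_le_span_of_encard_eq {K V ι : Type*} [Field K] [AddCommGroup V] [Module K V]
    {f : Module.End K V} {μ : ι → K} {v : ι → V} (hv : LinearIndependent K v)
    (hf : ∀ i, f (v i) = μ i • v i) {c : K} [FiniteDimensional K (f.eigenspace c)]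
    (hc : {i | μ i = c}.encard = Module.finrank K (f.eigenspace c)) :
    f.eigenspace c ≤ Submodule.span K (Set.range v) := by
  have hfin : {i | μ i = c}.Finite := by
    rw [← Set.encard_lt_top_iff, hc]
    exact ENat.natCast_lt_top _
  have := hfin.fintype
  let w (i : {i | μ i = c}) : f.eigenspace c :=
    ⟨v i, Module.End.mem_eigenspace_iff.mpr ((hf i).trans (by rw [i.2.out]))⟩
  have hw : LinearIndependent K w :=
    .of_comp (f.eigenspace c).subtype (hv.comp Subtype.val Subtype.val_injective)
  have hcard : Fintype.card {i | μ i = c} = Module.finrank K (f.eigenspace c) := by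
    rw [← Set.coe_fintypeCard] at hc
    exact_mod_cast hc
  have hspan := congrArg (Submodule.map (f.eigenspace c).subtype)
    (hw.span_eq_top_of_card_eq_finrank' hcard)
  rw [Submodule.map_span, Submodule.map_top, Submodule.range_subtype] at hspan
  rw [← hspan]
  refine Submodule.span_mono ?_
  rintro _ ⟨_, ⟨i, rfl⟩, rfl⟩
  exact ⟨i, rfl⟩

lemma orthogonal_le_ker_of_eigenspace_le {F : Type*} [NormedAddCommGroup F]
    [InnerProductSpace ℝ F] [CompleteSpace F] {A : F →L[ℝ] F} (hA : IsCompactOperator A)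
    (hsymm : (A : F →ₗ[ℝ] F).IsSymmetric) {W : Submodule ℝ F}
    (hW : ∀ c ≠ 0, Module.End.eigenspace (A : F →ₗ[ℝ] F) c ≤ W) : Wᗮ ≤ A.ker := by
  intro x hx
  have hAx : A x ∈ (⨆ c, Module.End.eigenspace (A : F →ₗ[ℝ] F) c)ᗮ := by
    rw [← Submodule.iInf_orthogonal, Submodule.mem_iInf]
    intro c y hy
    have hyx : ⟪y, A x⟫_ℝ = c * ⟪y, x⟫_ℝ := by
      rw [← real_inner_smul_left, ← Module.End.mem_eigenspace_iff.mp hy]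
      exact (hsymm y x).symm
    obtain rfl | hc := eq_or_ne c 0
    · rw [hyx, zero_mul]
    · rw [hyx, hx y (hW c hc hy), mul_zero]
  rwa [ContinuousLinearMap.orthogonalComplement_iSup_eigenspaces_eq_bot hA hsymm] at hAx

end Spectral

lemma norm_sq_eq_integral_sq {α : Type*} [MeasurableSpace α] {m : Measure α} (f : Lp ℝ 2 m) :
    ‖f‖ ^ 2 = ∫ x, f x ^ 2 ∂m := by
  rw [← real_inner_self_eq_norm_sq, L2.inner_def]
  simp [sq]

section Embedding

variable {T H ι : Type*} [NormedAddCommGroup H] [InnerProductSpace ℝ H] [CompleteSpace H]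
  [RKHS ℝ H T ℝ]

lemma norm_kerFun_one_le {t : T} {C : ℝ} (hC : 0 ≤ C) (h_eval : ∀ h : H, |h t| ≤ C * ‖h‖) :
    ‖RKHS.kerFun H t (1 : ℝ)‖ ≤ C := by
  rw [← innerSL_apply_norm (𝕜 := ℝ)]
  exact ContinuousLinearMap.opNorm_le_bound _ hC fun h => by simpa using h_eval h

lemma sum_sq_apply_le_norm_kerFun_sq {b : ι → H} (hb : Orthonormal ℝ b) (s : Finset ι) (t : T) :
    ∑ i ∈ s, b i t ^ 2 ≤ ‖RKHS.kerFun H t (1 : ℝ)‖ ^ 2 := by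
  simpa using hb.sum_inner_products_le (s := s) (RKHS.kerFun H t (1 : ℝ))

variable [MeasurableSpace T]

lemma norm_toL2_sq (hH : BoundedMeasurable (T := T) H) (ν : Measure T) [IsFiniteMeasure ν]
    (h : H) : ‖toL2 hH ν h‖ ^ 2 = ∫ t, h t ^ 2 ∂ν := by
  rw [norm_sq_eq_integral_sq]
  refine integral_congr_ae ?_
  filter_upwards [coeFn_toL2 hH ν h] with t ht
  rw [ht]

lemma isHilbertSchmidt_toL2 (hH : BoundedMeasurable (T := T) H) (ν : Measure T)
    [IsFiniteMeasure ν] : IsHilbertSchmidt (toL2 hH ν) := by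
  obtain ⟨C, hC0, hC⟩ := hH.exists_bound
  obtain ⟨J, b, -⟩ := exists_hilbertBasis ℝ H
  have hint i : Integrable (fun t => b i t ^ 2) ν := (hH.memLp ν (b i)).integrable_sq
  refine ⟨J, b, summable_of_sum_le (c := ∫ _, C ^ 2 ∂ν) (fun i => sq_nonneg _) fun s => ?_⟩
  simp only [norm_toL2_sq]
  rw [← integral_finsetSum _ fun i _ => hint i]
  refine integral_mono (integrable_finsetSum _ fun i _ => hint i) (integrable_const _) fun t => ?_
  have hker : ‖RKHS.kerFun H t (1 : ℝ)‖ ≤ C := norm_kerFun_one_le hC0 fun h => hC h t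
  exact (sum_sq_apply_le_norm_kerFun_sq b.orthonormal s t).trans
    (pow_le_pow_left₀ (norm_nonneg _) hker 2)

variable {hH : BoundedMeasurable (T := T) H} {ν : Measure T} [IsFiniteMeasure ν]
  {μ : ι → ℝ} {e : ι → H}

lemma IsEigensystem.orthogonal_span_le_ker_adjoint (he : IsEigensystem hH ν μ e) :
    (Submodule.span ℝ (Set.range fun i => toL2 hH ν (e i)))ᗮ ≤ (toL2 hH ν).adjoint.ker := by
  have hcomp : IsCompactOperator (integralOp hH ν) :=
    (isHilbertSchmidt_toL2 hH ν).isCompactOperator.comp_clm (toL2 hH ν).adjoint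
  have hsymm : (integralOp hH ν : Lp ℝ 2 ν →ₗ[ℝ] Lp ℝ 2 ν).IsSymmetric :=
    (ContinuousLinearMap.isPositive_self_comp_adjoint (toL2 hH ν)).isSymmetric
  rw [← ContinuousLinearMap.ker_self_comp_adjoint]
  refine orthogonal_le_ker_of_eigenspace_le hcomp hsymm fun c hc => ?_
  have := ContinuousLinearMap.finite_dimensional_eigenspace hcomp c hc
  exact eigenspace_le_span_of_encard_eq he.orthonormal.linearIndependent he.eigen
    (he.multiplicity c hc)

lemma IsEigensystem.isSingularSystem (he : IsEigensystem hH ν μ e) :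
    IsSingularSystem (toL2 hH ν) (fun i => √(μ i))
      (fun i => (√(μ i))⁻¹ • (toL2 hH ν).adjoint (toL2 hH ν (e i)))
      fun i => toL2 hH ν (e i) :=
  .of_eigenvectors he.pos he.orthonormal he.eigen he.orthogonal_span_le_ker_adjoint

lemma IsEigensystem.exists_hilbertBasis (he : IsEigensystem hH ν μ e)
    (hν : IsPositiveFor hH ν) : ∃ b : HilbertBasis ι ℝ H, ∀ i, b i = √(μ i) • e i := by
  have hsing := he.isSingularSystem
  refine ⟨.mkOfOrthogonalEqBot hsing.orthonormal_right (hsing.orthogonal_span_right_eq_bot hν),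
    fun i => hν ?_⟩
  rw [HilbertBasis.coe_mkOfOrthogonalEqBot, hsing.apply_right, map_smul]

lemma exists_powerSpace_apply_eq (he : IsEigensystem hH ν μ e) {β : ℝ} (hβ : 0 < β)
    (hs : PowerSummable μ e β) (i : ι) (c : ℝ) :
    ∃ g : PowerSpace he hβ hs, ‖g‖ = |c| ∧ ∀ t, g t = c * (μ i ^ (β / 2) * e i t) := by
  classical
  let a : lp (fun _ : ι => ℝ) 2 := lp.single 2 i c
  have ha_norm : ‖a‖ = |c| := by rw [lp.norm_single (by norm_num), Real.norm_eq_abs]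
  have ha_sum t : ∑' j, a j * (μ j ^ (β / 2) * e j t) = c * (μ i ^ (β / 2) * e i t) := by
    rw [tsum_eq_single i fun j hj => by simp [a, lp.single_apply, hj]]
    simp [a, lp.single_apply]
  exact ⟨a, ha_norm, ha_sum⟩

lemma IsEigensystem.nuclearlyDominated_powerSpace_iff (he : IsEigensystem hH ν μ e)
    (hν : IsPositiveFor hH ν) {β : ℝ} (hβ : 0 < β) (hs : PowerSummable μ e β) :
    NuclearlyDominated H (PowerSpace he hβ hs) ↔ Summable fun i => μ i ^ (1 - β) := by
  obtain ⟨b, hb⟩ := he.exists_hilbertBasis hν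
  choose g hg_norm hg_apply using fun i =>
    exists_powerSpace_apply_eq he hβ hs i (μ i ^ ((1 - β) / 2))
  have hg i t : g i t = b i t := by
    have hsqrt : √(μ i) = μ i ^ ((1 - β) / 2) * μ i ^ (β / 2) := by
      rw [← Real.rpow_add (he.pos i), Real.sqrt_eq_rpow]
      ring_nf
    rw [hg_apply, hb, RKHS.coe_smul, Pi.smul_apply, smul_eq_mul, hsqrt, mul_assoc]
  have hg_norm_sq i : ‖g i‖ ^ 2 = μ i ^ (1 - β) := by
    rw [hg_norm, sq_abs, ← Real.rpow_natCast, ← Real.rpow_mul (he.pos i).le]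
    norm_num
  simp only [nuclearlyDominated_iff_of_hilbertBasis b hg, hg_norm_sq]

end Embedding

section Loeve

lemma norm_linearCombination_eq_of_inner_eq {E F ι : Type*} [NormedAddCommGroup E]
    [InnerProductSpace ℝ E] [NormedAddCommGroup F] [InnerProductSpace ℝ F] {u : ι → E} {v : ι → F}
    (h : ∀ i j, ⟪u i, u j⟫_ℝ = ⟪v i, v j⟫_ℝ) (c : ι →₀ ℝ) :
    ‖Finsupp.linearCombination ℝ u c‖ = ‖Finsupp.linearCombination ℝ v c‖ := by
  rw [← sq_eq_sq₀ (norm_nonneg _) (norm_nonneg _), ← real_inner_self_eq_norm_sq,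
    ← real_inner_self_eq_norm_sq]
  simp only [Finsupp.linearCombination_apply, Finsupp.sum_inner, Finsupp.inner_sum,
    real_inner_smul_left, real_inner_smul_right, h]

lemma exists_clm_apply_eq_of_inner_eq {E F ι : Type*} [NormedAddCommGroup E]
    [InnerProductSpace ℝ E] [NormedAddCommGroup F] [InnerProductSpace ℝ F] [CompleteSpace F]
    {u : ι → E} {v : ι → F} (h : ∀ i j, ⟪u i, u j⟫_ℝ = ⟪v i, v j⟫_ℝ)
    (hu : (Submodule.span ℝ (Set.range u)).topologicalClosure = ⊤) :
    ∃ Ψ : E →L[ℝ] F, ∀ i, Ψ (u i) = v i := by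
  let U := Finsupp.linearCombination ℝ u
  let V := Finsupp.linearCombination ℝ v
  have hdense : DenseRange U := by
    rwa [← Submodule.dense_iff_topologicalClosure_eq_top, ← Finsupp.range_linearCombination] at hu
  have hbound : ∃ C, ∀ c, ‖V c‖ ≤ C * ‖U c‖ :=
    ⟨1, fun c => by rw [one_mul, norm_linearCombination_eq_of_inner_eq h]⟩
  refine ⟨V.extendOfNorm U, fun i => ?_⟩
  simpa [U, V] using LinearMap.extendOfNorm_eq hdense hbound (Finsupp.single i 1)

lemma topologicalClosure_span_kerFun_one {T : Type*} (H : Type*) [NormedAddCommGroup H]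
    [InnerProductSpace ℝ H] [CompleteSpace H] [RKHS ℝ H T ℝ] :
    (Submodule.span ℝ (Set.range fun t : T => RKHS.kerFun H t (1 : ℝ))).topologicalClosure =
      ⊤ := by
  refine eq_top_mono (Submodule.topologicalClosure_mono ?_) (RKHS.kerFun_dense H)
  refine Submodule.span_le.mpr ?_
  rintro _ ⟨t, v, rfl⟩
  rw [show v = v • (1 : ℝ) by rw [smul_eq_mul, mul_one], map_smul]
  exact Submodule.smul_mem _ _ (Submodule.subset_span ⟨t, rfl⟩)

variable {Ω T H : Type*} [MeasurableSpace Ω] {P : Measure Ω} {X : T → Ω → ℝ}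
  [NormedAddCommGroup H] [InnerProductSpace ℝ H] [CompleteSpace H] [RKHS ℝ H T ℝ]

lemma inner_toLp_eq_covFun (hX : ∀ t, MemLp (X t) 2 P) (s t : T) :
    ⟪(hX s).toLp (X s), (hX t).toLp (X t)⟫_ℝ = covFun X P s t := by
  rw [L2.inner_def]
  refine integral_congr_ae ?_
  filter_upwards [(hX s).coeFn_toLp, (hX t).coeFn_toLp] with ω hs ht
  simp [hs, ht, mul_comm]

lemma exists_loeve_map (hX : ∀ t, MemLp (X t) 2 P)
    (hK : RKHS.kernel H = kernelMatrix (covFun X P)) :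
    ∃ Ψ : H →L[ℝ] Lp ℝ 2 P, ∀ t, Ψ (RKHS.kerFun H t (1 : ℝ)) = (hX t).toLp (X t) := by
  refine exists_clm_apply_eq_of_inner_eq (fun s t => ?_) (topologicalClosure_span_kerFun_one H)
  rw [← RKHS.kernel_inner, hK, real_inner_comm ((hX t).toLp (X t)), inner_toLp_eq_covFun]
  simp [kernelMatrix]

end Loeve

lemma hasSum_apply_of_hasSum {T H ι : Type*} [NormedAddCommGroup H] [InnerProductSpace ℝ H]
    [RKHS ℝ H T ℝ] {g : ι → H} {h : H} (hg : HasSum g h) (t : T) :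
    HasSum (fun i => g i t) (h t) := by
  simpa using hg.mapL (ContinuousLinearMap.proj t ∘L RKHS.coeCLM ℝ (H := H) : H →L[ℝ] ℝ)

section Paths

variable {Ω ι : Type*} [MeasurableSpace Ω] {P : Measure Ω} [Countable ι] {x : ι → Lp ℝ 2 P}

lemma ae_summable_sq (hx : Summable fun i => ‖x i‖ ^ 2) :
    ∀ᵐ ω ∂P, Summable fun i => x i ω ^ 2 := by
  have hm i : Measurable fun ω => ENNReal.ofReal (x i ω ^ 2) :=
    ((Lp.stronglyMeasurable (x i)).measurable.pow_const 2).ennreal_ofReal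
  have hnorm i : ∫⁻ ω, ENNReal.ofReal (x i ω ^ 2) ∂P = ENNReal.ofReal (‖x i‖ ^ 2) := by
    rw [norm_sq_eq_integral_sq, ofReal_integral_eq_lintegral_ofReal (Lp.memLp _).integrable_sq
      (ae_of_all _ fun ω => sq_nonneg _)]
  have hfin : ∀ᵐ ω ∂P, ∑' i, ENNReal.ofReal (x i ω ^ 2) < ⊤ := by
    refine ae_lt_top (Measurable.tsum hm) ?_
    rw [lintegral_tsum fun i => (hm i).aemeasurable]
    simpa only [hnorm] using hx.tsum_ofReal_ne_top
  filter_upwards [hfin] with ω hω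
  exact (ENNReal.summable_toReal hω.ne).congr fun i =>
    ENNReal.toReal_ofReal (sq_nonneg _)

lemma exists_measurable_ae_eq_summable_sq (hx : Summable fun i => ‖x i‖ ^ 2) :
    ∃ y : ι → Ω → ℝ, (∀ i, Measurable (y i)) ∧ (∀ i, y i =ᵐ[P] x i) ∧
      ∀ ω, Summable fun i => y i ω ^ 2 := by
  obtain ⟨A, hA, hAm, hAx⟩ := (ae_summable_sq hx).exists_measurable_mem
  refine ⟨fun i => A.indicator (x i),
    fun i => (Lp.stronglyMeasurable (x i)).measurable.indicator hAm, fun i => ?_, fun ω => ?_⟩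
  · filter_upwards [hA] with ω hω
    exact Set.indicator_of_mem hω _
  · by_cases hω : ω ∈ A
    · simpa only [Set.indicator_of_mem hω] using hAx ω hω
    · simpa only [Set.indicator_of_notMem hω, zero_pow two_ne_zero] using summable_zero

lemma ae_eq_of_hasSum_Lp {g : ι → Lp ℝ 2 P} {Z : Lp ℝ 2 P} (hZ : HasSum g Z) {Y : Ω → ℝ}
    (hY : ∀ᵐ ω ∂P, HasSum (fun i => g i ω) (Y ω)) : Y =ᵐ[P] Z := by
  obtain ⟨ns, hns, hae⟩ := (tendstoInMeasure_of_tendsto_Lp hZ).exists_seq_tendsto_ae'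
  have hcoe := ae_all_iff.mpr fun n => Lp.coeFn_finsetSum (ns n) g
  filter_upwards [hY, hae, hcoe] with ω hYω hZω hcoeω
  refine tendsto_nhds_unique (hYω.comp hns) (hZω.congr fun n => ?_)
  rw [hcoeω]
  simp

variable {T H : Type*} {X : T → Ω → ℝ} [NormedAddCommGroup H] [InnerProductSpace ℝ H]
  [CompleteSpace H] [RKHS ℝ H T ℝ]

lemma exists_version_of_hasSum (hX : ∀ t, MemLp (X t) 2 P) {f : ι → H} (hf : Orthonormal ℝ f)
    (hx : Summable fun i => ‖x i‖ ^ 2)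
    (hfx : ∀ t, HasSum (fun i => f i t • x i) ((hX t).toLp (X t))) :
    ∃ Y : T → Ω → ℝ, IsVersion Y X P ∧ ∀ ω, ∃ h : H, ∀ t, h t = Y t ω := by
  obtain ⟨y, hym, hyx, hy⟩ := exists_measurable_ae_eq_summable_sq hx
  have hpath ω : Summable fun i => y i ω • f i := by
    refine (hf.orthogonalFamily.summable_iff_norm_sq_summable fun i => y i ω).mpr ?_
    simpa using hy ω
  let Y (t : T) (ω : Ω) : ℝ := (∑' i, y i ω • f i : H) t
  have hY t ω : HasSum (fun i => f i t * y i ω) (Y t ω) := by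
    simpa [mul_comm] using hasSum_apply_of_hasSum (hpath ω).hasSum t
  refine ⟨Y, fun t => ⟨?_, ?_⟩, fun ω => ⟨_, fun t => rfl⟩⟩
  · refine measurable_of_tendsto_metrizable' (atTop : Filter (Finset ι))
      (f := fun s ω => ∑ i ∈ s, f i t * y i ω) (fun s => ?_) (tendsto_pi_nhds.mpr fun ω => hY t ω)
    exact Finset.measurable_fun_sum _ fun i _ => (hym i).const_mul _
  · refine (ae_eq_of_hasSum_Lp (hfx t) ?_).trans (hX t).coeFn_toLp
    have hsmul := ae_all_iff.mpr fun i => Lp.coeFn_smul (f i t) (x i)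
    filter_upwards [ae_all_iff.mpr hyx, hsmul] with ω hyω hsmulω
    simpa [hsmulω, hyω] using hY t ω

end Paths

section LukicBeder

variable {Ω T H₁ H₂ : Type*} [MeasurableSpace Ω] {P : Measure Ω} {X : T → Ω → ℝ}
  [NormedAddCommGroup H₁] [InnerProductSpace ℝ H₁] [CompleteSpace H₁] [RKHS ℝ H₁ T ℝ]
  [NormedAddCommGroup H₂] [InnerProductSpace ℝ H₂] [CompleteSpace H₂] [RKHS ℝ H₂ T ℝ]

lemma adjoint_kerFun_one {J : H₁ →L[ℝ] H₂} (hJ : ∀ h t, J h t = h t) (t : T) :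
    J.adjoint (RKHS.kerFun H₂ t (1 : ℝ)) = RKHS.kerFun H₁ t 1 :=
  ext_inner_right ℝ fun h => by simp [ContinuousLinearMap.adjoint_inner_left, hJ]

lemma hasSum_smul_kerFun_one {κ : Type*} (f : HilbertBasis κ ℝ H₂) (t : T) :
    HasSum (fun k => f k t • f k) (RKHS.kerFun H₂ t (1 : ℝ)) := by
  simpa [HilbertBasis.repr_apply_apply] using f.hasSum_repr (RKHS.kerFun H₂ t (1 : ℝ))

lemma exists_version_of_nuclearlyDominated (hX : ∀ t, MemLp (X t) 2 P)
    (hK : RKHS.kernel H₁ = kernelMatrix (covFun X P)) (hdom : NuclearlyDominated H₁ H₂) :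
    ∃ Y : T → Ω → ℝ, IsVersion Y X P ∧ ∀ ω, ∃ h : H₂, ∀ t, h t = Y t ω := by
  obtain ⟨J, hJ, hS⟩ := hdom
  obtain ⟨Ψ, hΨ⟩ := exists_loeve_map hX hK
  obtain ⟨κ, f, -⟩ := exists_hilbertBasis ℝ H₂
  let x (k : κ) : Lp ℝ 2 P := Ψ (J.adjoint (f k))
  have hx : Summable fun k => ‖x k‖ ^ 2 := by
    refine ((hS.summable_adjoint f).mul_left (‖Ψ‖ ^ 2)).of_nonneg_of_le
      (fun k => sq_nonneg _) fun k => ?_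
    rw [← mul_pow]
    exact pow_le_pow_left₀ (norm_nonneg _) (Ψ.le_opNorm _) 2
  have hfx t : HasSum (fun k => f k t • x k) ((hX t).toLp (X t)) := by
    simpa [x, adjoint_kerFun_one hJ, hΨ] using
      (hasSum_smul_kerFun_one f t).mapL (Ψ ∘L J.adjoint)
  set s := Function.support fun k => ‖x k‖ ^ 2 with hs
  have : Countable s := hx.countable_support.to_subtype
  refine exists_version_of_hasSum hX (f.orthonormal.comp ((↑) : s → κ) Subtype.val_injective)
    (hx.subtype s) fun t => (hasSum_subtype_iff_of_support_subset (s := s) ?_).mpr (hfx t)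
  refine Function.support_subset_iff'.mpr fun k hk => ?_
  have hxk : x k = 0 := by simpa [hs] using hk
  rw [hxk, smul_zero]

end LukicBeder

end GaussianPaths

theorem mainTheorem3_general {Ω T H ι : Type*} [MeasurableSpace Ω] [MeasurableSpace T]
    [NormedAddCommGroup H] [InnerProductSpace ℝ H] [CompleteSpace H] [RKHS ℝ H T ℝ]
    {P : Measure Ω} {ν : Measure T} [IsFiniteMeasure ν] {X : T → Ω → ℝ}
    (hX : ∀ t, MemLp (X t) 2 P)
    (hK : RKHS.kernel H = GaussianPaths.kernelMatrix (GaussianPaths.covFun X P))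
    {hH : GaussianPaths.BoundedMeasurable (T := T) H} {μ : ι → ℝ} {e : ι → H}
    (he : GaussianPaths.IsEigensystem hH ν μ e) :
    (GaussianPaths.IsNuclear (GaussianPaths.toL2 hH ν) ↔ Summable fun i => √(μ i)) ∧
    (GaussianPaths.IsPositiveFor hH ν →
      ∀ (β : ℝ) (hβ : 0 < β) (hs : GaussianPaths.PowerSummable μ e β),
        (GaussianPaths.NuclearlyDominated H (GaussianPaths.PowerSpace he hβ hs) ↔
          Summable fun i => μ i ^ (1 - β)) ∧
        (GaussianPaths.NuclearlyDominated H (GaussianPaths.PowerSpace he hβ hs) →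
          ∃ Y : T → Ω → ℝ, GaussianPaths.IsVersion Y X P ∧
            ∀ ω, ∃ f : GaussianPaths.PowerSpace he hβ hs, ∀ t, f t = Y t ω)) :=
  ⟨he.isSingularSystem.isNuclear_iff, fun hν _ hβ hs =>
    ⟨he.nuclearlyDominated_powerSpace_iff hν hβ hs,
      GaussianPaths.exists_version_of_nuclearlyDominated hX hK⟩⟩

theorem mainTheorem3 {Ω T ι : Type*} [MeasurableSpace Ω] [MeasurableSpace T]
    (P : Measure Ω) [IsProbabilityMeasure P] (ν : Measure T) [IsFiniteMeasure ν]
    (X : T → Ω → ℝ) (hX : GaussianPaths.IsCenteredGaussianProcess X P)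
    (hH : GaussianPaths.BoundedMeasurable (T := T) (GaussianPaths.CovRKHS hX))
    (μ : ι → ℝ) (e : ι → GaussianPaths.CovRKHS hX)
    (he : GaussianPaths.IsEigensystem hH ν μ e) :
    (GaussianPaths.IsNuclear (GaussianPaths.toL2 hH ν) ↔ Summable fun i => √(μ i)) ∧
    (GaussianPaths.IsPositiveFor hH ν →
      ∀ (β : ℝ) (hβ : 0 < β), β < 1 → ∀ hs : GaussianPaths.PowerSummable μ e β,
        (GaussianPaths.NuclearlyDominated (GaussianPaths.CovRKHS hX)
            (GaussianPaths.PowerSpace he hβ hs) ↔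
          Summable fun i => μ i ^ (1 - β)) ∧
        (GaussianPaths.NuclearlyDominated (GaussianPaths.CovRKHS hX)
            (GaussianPaths.PowerSpace he hβ hs) →
          ∃ Y : T → Ω → ℝ, GaussianPaths.IsVersion Y X P ∧
            ∀ᵐ ω ∂P, ∃ f : GaussianPaths.PowerSpace he hβ hs, ∀ t, f t = Y t ω)) := by
  obtain ⟨hnuclear, hpower⟩ := mainTheorem3_general
    (fun t => (hX.gaussian.hasGaussianLaw_eval t).memLp_two) (GaussianPaths.kernel_covRKHS hX) he
  exact ⟨hnuclear, fun hν β hβ _ hs => (hpower hν β hβ hs).imp_right fun hversion hdom =>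
    (hversion hdom).imp fun Y hY => hY.imp_right (ae_of_all P)⟩
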